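/- There is an absolute constant $C>0$ such that the following holds for every $0<\varepsilon\le 1$ and every finite set $P\subset\mathbb{R}^2$ with at least two points. Let $$\Delta=\frac{\max_{p\ne q\in P}\|p-q\|}{\min_{p\ne q\in P}\|p-q\|}$$ be the spread of $P$, and let $w(\mathrm{MST}(P))$ be the weight of a minimum spanning tree of $P$ with respect to Euclidean distances. Then $P$ admits a Steiner $(1+\varepsilon)$-spanner of weight at most $$C\cdot\frac{\max\{1,\log_2\Delta\}}{\varepsilon}\cdot w(\mathrm{MST}(P)),$$ that is, of lightness $O\!\left(\frac{\log\Delta}{\varepsilon}\right)$ whenever $\Delta\ge 2$. Here a Steiner $(1+\varepsilon)$-spanner for $P$ is a finite graph $G$ whose vertex set is a finite set of points $V\subset\mathbb{R}^2$ with $P\subseteq V$, whose edges $pq$ have weight $\|p-q\|$, and whose shortest-path distance satisfies $d_G(p,q)\le(1+\varepsilon)\|p-q\|$ for all distinct $p,q\in P$; its weight is the sum of the weights of its edges. -/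

import Mathlib

noncomputable section

namespace Geometric

variable {E : Type*} [MetricSpace E]

/-- The weight of the edge `s(p, q)` of a geometric graph: the distance between `p` and `q`. -/
def edgeWeight {V : Finset E} : Sym2 V → ℝ :=
  Sym2.lift ⟨fun p q => dist (p : E) (q : E), fun p q => dist_comm (p : E) (q : E)⟩

open Classical in
/-- The weight of a geometric graph on a finite vertex set `V` of points:
the sum of the weights of its edges. -/
def weight {V : Finset E} (G : SimpleGraph V) : ℝ :=
  ∑ e ∈ G.edgeFinset, edgeWeight e

/-- The weight of a walk: the sum of the weights of the edges it traverses, with multiplicity. -/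
def walkWeight {V : Finset E} {G : SimpleGraph V} {p q : V} (w : G.Walk p q) : ℝ :=
  (w.edges.map edgeWeight).sum

/-- The distance `d_G(p, q)` in a geometric graph: the least weight of a walk from `p` to `q`,
and `∞` if there is none. -/
def graphDist {V : Finset E} (G : SimpleGraph V) (p q : V) : ENNReal :=
  ⨅ w : G.Walk p q, ENNReal.ofReal (walkWeight w)

/-- `G`, a geometric graph with vertex set `V`, is a Steiner `t`-spanner for `P`. The points of
`V` outside `P` are the Steiner points. -/
structure IsSteinerSpanner (P : Finset E) {V : Finset E} (G : SimpleGraph V) (t : ℝ) : Prop where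
  subset : P ⊆ V
  stretch : ∀ p q : V, (p : E) ∈ P → (q : E) ∈ P → p ≠ q →
    graphDist G p q ≤ ENNReal.ofReal (t * dist (p : E) (q : E))

/-- The weight of a minimum spanning tree of `P`: the least weight of a tree with vertex
set `P`. (For nonempty `P` this is the infimum of a finite nonempty set, hence its minimum.) -/
def mstWeight (P : Finset E) : ℝ :=
  sInf {x : ℝ | ∃ T : SimpleGraph P, T.IsTree ∧ weight T = x}

/-- The spread of `P`: the ratio of the largest to the smallest distance between
distinct points of `P`. It is meaningful when `P` has at least two points. -/
def spread (P : Finset E) : ℝ :=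
  Metric.diam (P : Set E) / Set.infsep (P : Set E)

end Geometric

end

/-!
The spanner is a union of one graph for each of the `O(log Δ)` dyadic scales `L` of distances
between the minimum and the maximum distance of `P`. The graph at scale `L` serves the pairs at
distance in `[L, 2 * L)` and has weight `O(w(MST) / ε)`.

Fix `L` and let `δ = 2 ^ (-J)` be of order `√ε`. A path whose direction differs from that of
`q - p` by an angle `O(δ)` has relative excess length only `O(δ ^ 2) = O(ε)`, so it is enough to
provide paths along `O(1 / δ)` directions `d` (`exists_near_direction`).
For each `d` the points are collected in a tapering tree. At level `i ≤ J` take a net of `P` of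
radius `δ * L / 2 ^ i`, push its points by about `L / 10 * 3 ^ (-i)` in the direction `d`, and
join each point of one level to a nearby point of the next coarser one.
A separated set of radius `r` has at most `4 * w(MST) / r` points (`card_mul_le_weight`), so level
`i` weighs `O(w(MST) / δ * (2 / 3) ^ i)`; by `norm_smul_add_le` it contributes an excess length
`O(δ ^ 2 * L * (3 / 4) ^ i)`. Both series converge
(`totalLength_taper_le`, `exists_pathLE_taper`).
At the coarsest level, of radius `δ * L`, each point is joined to the `O(1)` nearby hubs of a
lattice with step `L / 10` along `d` and `δ * L` across it. Paths from `p` in direction `d` and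
from `q` in direction `-d` meet at the hub of their midpoint (`exists_pathLE_hub`,
`exists_graph_at_scale`). Multiplied by the number `O(1 / δ)` of directions, the weight is
`O(w(MST) / δ ^ 2)`.

These paths start at points of the finest net, within `δ ^ 2 * L` of `p` and `q`. The gaps are
filled by smaller scales, by induction (`pathLE_of_scales`), and cost another `O(ε * L)`.
-/

open Geometric

/-! ### Geometric graphs from finite sets of segments -/

/-- `PathLE S a b ℓ`: the segments in `S`, traversed in either direction, form a path from `a` to
`b` of length at most `ℓ`. -/
inductive PathLE {E : Type*} [MetricSpace E] (S : Finset (E × E)) : E → E → ℝ → Prop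
  | nil (a : E) (l : ℝ) (hl : 0 ≤ l) : PathLE S a a l
  | cons (a b c : E) (l l' : ℝ) (h : (a, b) ∈ S ∨ (b, a) ∈ S) (hp : PathLE S b c l)
      (hl : dist a b + l ≤ l') : PathLE S a c l'

namespace PathLE

variable {E : Type*} [MetricSpace E] {S T : Finset (E × E)} {a b c : E} {l l' : ℝ}

lemma mono_length (h : PathLE S a b l) (hl : l ≤ l') : PathLE S a b l' := by
  cases h with
  | nil _ _ h0 => exact .nil _ _ (h0.trans hl)
  | cons _ b _ l1 _ hab hp h1 => exact .cons _ b _ l1 _ hab hp (h1.trans hl)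

lemma mono_set (h : PathLE S a b l) (hST : S ⊆ T) : PathLE T a b l := by
  induction h with
  | nil a l h0 => exact .nil _ _ h0
  | cons a b c l l' hab _ hl ih =>
    exact .cons _ b _ l _ (hab.imp (fun h => hST h) (fun h => hST h)) ih hl

lemma single (h : (a, b) ∈ S ∨ (b, a) ∈ S) (hl : dist a b ≤ l) : PathLE S a b l :=
  .cons _ b _ 0 _ h (.nil _ _ le_rfl) (by simpa using hl)

lemma trans (h : PathLE S a b l) (h' : PathLE S b c l') : PathLE S a c (l + l') := by
  induction h with
  | nil a l h0 => exact h'.mono_length (by linarith)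
  | cons a b _ l _ hab _ hl ih => exact .cons _ b _ _ _ hab (ih h') (by linarith)

lemma symm (h : PathLE S a b l) : PathLE S b a l := by
  induction h with
  | nil a l h0 => exact .nil _ _ h0
  | cons a b c l l' hab _ hl ih =>
    exact (ih.trans (single hab.symm (dist_comm b a).le)).mono_length (by linarith)

end PathLE

/-- The total length of a finite set of segments. -/
noncomputable def totalLength {E : Type*} [MetricSpace E] (S : Finset (E × E)) : ℝ :=
  ∑ e ∈ S, dist e.1 e.2

section TotalLength

variable {E ι : Type*} [MetricSpace E]

lemma totalLength_union_le [DecidableEq (E × E)] (S T : Finset (E × E)) :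
    totalLength (S ∪ T) ≤ totalLength S + totalLength T := by
  unfold totalLength
  rw [← Finset.sum_union_inter]
  exact le_add_of_nonneg_right (Finset.sum_nonneg fun _ _ => dist_nonneg)

lemma totalLength_biUnion_le [DecidableEq (E × E)] (A : Finset ι) (f : ι → Finset (E × E)) :
    totalLength (A.biUnion f) ≤ ∑ i ∈ A, totalLength (f i) := by
  classical
  induction A using Finset.induction_on with
  | empty => simp [totalLength]
  | insert i A hi ih =>
    rw [Finset.biUnion_insert, Finset.sum_insert hi]
    exact (totalLength_union_le _ _).trans (by gcongr)

lemma totalLength_image_le [DecidableEq (E × E)] (A : Finset ι) (f : ι → E × E) {B : ℝ}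
    (h : ∀ i ∈ A, dist (f i).1 (f i).2 ≤ B) : totalLength (A.image f) ≤ A.card * B := by
  calc totalLength (A.image f) ≤ ∑ i ∈ A, dist (f i).1 (f i).2 :=
        Finset.sum_image_le_of_nonneg (f := fun e : E × E => dist e.1 e.2)
          (fun _ _ => dist_nonneg)
    _ ≤ ∑ _i ∈ A, B := Finset.sum_le_sum h
    _ = A.card * B := by simp

end TotalLength

lemma edgeWeight_nonneg {E : Type*} [MetricSpace E] {V : Finset E} (e : Sym2 V) :
    0 ≤ edgeWeight e := by
  induction e with
  | _ u v => exact dist_nonneg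

/-- A finite set of segments joining all pairs of `P` by short paths yields a Steiner spanner
whose Steiner points are the endpoints of the segments outside `P`. -/
lemma exists_isSteinerSpanner_of_pathLE {E : Type*} [MetricSpace E] (P : Finset E)
    (S : Finset (E × E)) (t : ℝ)
    (h : ∀ p ∈ P, ∀ q ∈ P, PathLE S p q (t * dist p q)) :
    ∃ (V : Finset E) (G : SimpleGraph V), IsSteinerSpanner P G t ∧ weight G ≤ totalLength S := by
  classical
  set V : Finset E := P ∪ (S.image Prod.fst ∪ S.image Prod.snd) with hV
  have hV1 : ∀ e ∈ S, e.1 ∈ V := fun e he =>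
    Finset.mem_union_right _ (Finset.mem_union_left _ (Finset.mem_image_of_mem _ he))
  have hV2 : ∀ e ∈ S, e.2 ∈ V := fun e he =>
    Finset.mem_union_right _ (Finset.mem_union_right _ (Finset.mem_image_of_mem _ he))
  let G : SimpleGraph V :=
    { Adj := fun u v => u ≠ v ∧ (((u : E), (v : E)) ∈ S ∨ ((v : E), (u : E)) ∈ S)
      symm := ⟨fun u v huv => ⟨huv.1.symm, huv.2.symm⟩⟩
      loopless := ⟨fun u hu => hu.1 rfl⟩ }
  have walk : ∀ (a b : E) (l : ℝ), PathLE S a b l → ∀ (ha : a ∈ V) (hb : b ∈ V),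
      ∃ w : G.Walk ⟨a, ha⟩ ⟨b, hb⟩, walkWeight w ≤ l := by
    intro a b l hp
    induction hp with
    | nil a l h0 => exact fun ha hb => ⟨.nil, by simpa [walkWeight] using h0⟩
    | cons a b c l l' hab _ hl ih =>
      intro ha hc
      have hb : b ∈ V := hab.elim (fun h => hV2 _ h) (fun h => hV1 _ h)
      obtain ⟨w, hw⟩ := ih hb hc
      by_cases hne : a = b
      · subst hne
        exact ⟨w, hw.trans (by simpa using hl)⟩
      · have hadj : G.Adj ⟨a, ha⟩ ⟨b, hb⟩ := ⟨fun h => hne (congrArg Subtype.val h), hab⟩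
        refine ⟨.cons hadj w, ?_⟩
        have : walkWeight (SimpleGraph.Walk.cons hadj w) = dist a b + walkWeight w := by
          simp [walkWeight, edgeWeight]
        linarith
  refine ⟨V, G, ⟨Finset.subset_union_left, ?_⟩, ?_⟩
  · intro p q hp hq _
    obtain ⟨w, hw⟩ := walk p q _ (h p hp q hq) p.2 q.2
    exact (iInf_le _ w).trans (ENNReal.ofReal_le_ofReal hw)
  · let f : {e // e ∈ S} → Sym2 V := fun e => s(⟨e.1.1, hV1 _ e.2⟩, ⟨e.1.2, hV2 _ e.2⟩)
    have hsub : G.edgeFinset ⊆ S.attach.image f := by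
      intro e he
      rw [SimpleGraph.mem_edgeFinset] at he
      induction e with
      | _ u v =>
        rw [SimpleGraph.mem_edgeSet] at he
        rw [Finset.mem_image]
        rcases he.2 with h1 | h1
        · exact ⟨⟨_, h1⟩, Finset.mem_attach _ _, rfl⟩
        · exact ⟨⟨_, h1⟩, Finset.mem_attach _ _, Sym2.eq_swap⟩
    have h1 : weight G ≤ ∑ e ∈ S.attach.image f, edgeWeight e := by
      unfold weight
      refine Finset.sum_le_sum_of_subset_of_nonneg (fun e he => hsub ?_)
        (fun e _ _ => edgeWeight_nonneg e)
      simpa using he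
    have h2 : ∑ e ∈ S.attach.image f, edgeWeight e ≤ ∑ e ∈ S.attach, edgeWeight (f e) :=
      Finset.sum_image_le_of_nonneg (fun e _ => edgeWeight_nonneg e)
    have h3 : ∑ e ∈ S.attach, edgeWeight (f e) = totalLength S :=
      Finset.sum_attach S (fun e : E × E => dist e.1 e.2)
    linarith

/-! ### Lower bounds on the weight of a spanning tree -/

section EdgeVariation

variable {E : Type*} {P : Finset E}

/-- The absolute increment of a function along an edge. -/
def edgeVariation (g : E → ℝ) : Sym2 P → ℝ :=
  Sym2.lift ⟨fun u v => |g u - g v|, fun _ _ => abs_sub_comm _ _⟩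

lemma edgeVariation_nonneg (g : E → ℝ) (e : Sym2 P) : 0 ≤ edgeVariation g e := by
  induction e with
  | _ u v => exact abs_nonneg _

lemma abs_sub_le_sum_edges (g : E → ℝ) {T : SimpleGraph P} {a b : P} (w : T.Walk a b) :
    |g a - g b| ≤ (w.edges.map (edgeVariation g)).sum := by
  induction w with
  | nil => simp
  | @cons u v w h p ih =>
    have h1 : edgeVariation g s(u, v) = |g u - g v| := rfl
    rw [SimpleGraph.Walk.edges_cons, List.map_cons, List.sum_cons, h1]
    exact (abs_sub_le _ (g v) _).trans (by gcongr)

open Classical in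
lemma abs_sub_le_sum_edgeVariation (g : E → ℝ) {T : SimpleGraph P} (hT : T.Connected) (a b : P) :
    |g a - g b| ≤ ∑ e ∈ T.edgeFinset, edgeVariation g e := by
  obtain ⟨w, hw⟩ := (hT.preconnected a b).exists_isPath
  refine (abs_sub_le_sum_edges g w).trans ?_
  rw [← List.sum_toFinset _ hw.isTrail.edges_nodup]
  refine Finset.sum_le_sum_of_subset_of_nonneg (fun e he => ?_)
    (fun e _ _ => edgeVariation_nonneg g e)
  rw [SimpleGraph.mem_edgeFinset]
  exact w.edges_subset_edgeSet (List.mem_toFinset.1 he)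

end EdgeVariation

section SpanningTree

variable {E : Type*} [MetricSpace E] {P : Finset E}

lemma dist_le_weight {T : SimpleGraph P} (hT : T.Connected) (a b : P) :
    dist (a : E) b ≤ weight T := by
  classical
  have h := abs_sub_le_sum_edgeVariation (fun x => dist x (b : E)) hT a b
  simp only [dist_self, sub_zero, abs_of_nonneg dist_nonneg] at h
  have hle : ∀ e : Sym2 P, edgeVariation (fun x => dist x (b : E)) e ≤ edgeWeight e := by
    intro e
    induction e with
    | _ u v => exact abs_dist_sub_le _ _ _
  refine h.trans ((Finset.sum_le_sum fun e _ => hle e).trans (le_of_eq ?_))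
  unfold weight
  congr!

/-- The bump functions of radius `r / 2` around the points of `N` have disjoint supports, so their
variations along an edge add up to at most twice the length of the edge, while each of them
varies by at least `r / 2` along a path leaving its center. -/
lemma card_mul_le_weight {T : SimpleGraph P} (hT : T.Connected) {N : Finset E} (hN : N ⊆ P)
    (hcard : 2 ≤ N.card) {r : ℝ} (hr : 0 < r)
    (hsep : ∀ x ∈ N, ∀ y ∈ N, x ≠ y → r ≤ dist x y) : N.card * r ≤ 4 * weight T := by
  classical
  let f : E → E → ℝ := fun x y => max 0 (r / 2 - dist x y)
  have hlow : ∀ x ∈ N, r / 2 ≤ ∑ e ∈ T.edgeFinset, edgeVariation (f x) e := by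
    intro x hx
    obtain ⟨y, hy, hyx⟩ := Finset.exists_mem_ne (by omega : 1 < N.card) x
    have h := abs_sub_le_sum_edgeVariation (f x) hT ⟨x, hN hx⟩ ⟨y, hN hy⟩
    have h1 : f x x = r / 2 := by
      simp only [f, dist_self, sub_zero]; exact max_eq_right (by linarith)
    have h2 : f x y = 0 := by
      have := hsep x hx y hy hyx.symm
      exact max_eq_left (by linarith)
    simp only [h1, h2, sub_zero] at h
    exact (le_abs_self _).trans h
  have hone : ∀ (u : E) (D : ℝ), 0 ≤ D →
      ∑ x ∈ N, (if dist x u < r / 2 then D else 0) ≤ D := by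
    intro u D hD
    rw [← Finset.sum_filter, Finset.sum_const, nsmul_eq_mul]
    have : (N.filter fun x => dist x u < r / 2).card ≤ 1 := by
      rw [Finset.card_le_one]
      intro x hx y hy
      rw [Finset.mem_filter] at hx hy
      by_contra hne
      have := hsep x hx.1 y hy.1 hne
      have := dist_triangle_right x y u
      linarith [hx.2, hy.2]
    have : ((N.filter fun x => dist x u < r / 2).card : ℝ) ≤ 1 := by exact_mod_cast this
    nlinarith
  have hup : ∀ e : Sym2 P, ∑ x ∈ N, edgeVariation (f x) e ≤ 2 * edgeWeight e := by
    intro e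
    induction e with
    | _ u v =>
      set D := dist (u : E) v with hD
      have key : ∀ x ∈ N, |f x u - f x v| ≤
          (if dist x u < r / 2 then D else 0) + (if dist x (v : E) < r / 2 then D else 0) := by
        intro x _
        have hD0 : 0 ≤ D := dist_nonneg
        have hlip : |f x u - f x v| ≤ D := by
          refine (abs_max_sub_max_le_max 0 _ 0 _).trans ?_
          rw [sub_self, abs_zero, sub_sub_sub_cancel_left]
          refine max_le hD0 ?_
          rw [hD, dist_comm x (v : E), dist_comm x (u : E), dist_comm (u : E) (v : E)]
          exact abs_dist_sub_le (v : E) u x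
        by_cases h1 : dist x u < r / 2
        · rw [if_pos h1]
          split_ifs <;> linarith
        · by_cases h2 : dist x (v : E) < r / 2
          · rw [if_neg h1, if_pos h2]; linarith
          · have e1 : f x u = 0 := max_eq_left (by linarith)
            have e2 : f x v = 0 := max_eq_left (by linarith)
            simp [h1, h2, e1, e2]
      calc ∑ x ∈ N, edgeVariation (f x) s(u, v) = ∑ x ∈ N, |f x u - f x v| := rfl
        _ ≤ _ := Finset.sum_le_sum key
        _ ≤ D + D := by
          rw [Finset.sum_add_distrib]
          exact add_le_add (hone _ _ dist_nonneg) (hone _ _ dist_nonneg)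
        _ = 2 * edgeWeight s(u, v) := by
          rw [← two_mul]; rfl
  have h1 : N.card * (r / 2) ≤ ∑ x ∈ N, ∑ e ∈ T.edgeFinset, edgeVariation (f x) e := by
    rw [← nsmul_eq_mul, ← Finset.sum_const]
    exact Finset.sum_le_sum hlow
  rw [Finset.sum_comm] at h1
  have h2 : ∑ e ∈ T.edgeFinset, ∑ x ∈ N, edgeVariation (f x) e
      ≤ ∑ e ∈ T.edgeFinset, 2 * edgeWeight e := Finset.sum_le_sum fun e _ => hup e
  rw [← Finset.mul_sum] at h2
  have h3 : ∑ e ∈ T.edgeFinset, edgeWeight e = weight T := by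
    unfold weight
    congr!
  rw [h3] at h2
  linarith

lemma le_mstWeight (hP : P.Nonempty) {x : ℝ}
    (h : ∀ T : SimpleGraph P, T.Connected → x ≤ weight T) : x ≤ mstWeight P := by
  have : Nonempty P := hP.to_subtype
  obtain ⟨T, -, hT⟩ := (SimpleGraph.connected_top (V := P)).exists_isTree_le
  refine le_csInf ⟨_, T, hT, rfl⟩ ?_
  rintro _ ⟨T, hT, rfl⟩
  exact h T hT.connected

lemma dist_le_mstWeight {a b : E} (ha : a ∈ P) (hb : b ∈ P) : dist a b ≤ mstWeight P :=
  le_mstWeight ⟨a, ha⟩ fun _ hT => dist_le_weight hT ⟨a, ha⟩ ⟨b, hb⟩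

lemma card_mul_le_mstWeight (hP : P.Nonempty) {N : Finset E} (hN : N ⊆ P) {r : ℝ} (hr : 0 < r)
    (hrP : r ≤ mstWeight P)
    (hsep : ∀ x ∈ N, ∀ y ∈ N, x ≠ y → r ≤ dist x y) : N.card * r ≤ 4 * mstWeight P := by
  rcases lt_or_ge N.card 2 with h | h
  · have : (N.card : ℝ) ≤ 1 := by exact_mod_cast Nat.lt_succ_iff.1 h
    nlinarith
  · have : N.card * r / 4 ≤ mstWeight P :=
      le_mstWeight hP fun T hT => by linarith [card_mul_le_weight hT hN h hr hsep]
    linarith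

end SpanningTree

/-! ### Nets -/

/-- A maximal `r`-separated subset covers within distance `r`. -/
lemma exists_separated_net {E : Type*} [MetricSpace E] (P : Finset E) {r : ℝ} (hr : 0 < r) :
    ∃ N ⊆ P, (∀ x ∈ N, ∀ y ∈ N, x ≠ y → r ≤ dist x y) ∧ ∀ x ∈ P, ∃ y ∈ N, dist x y ≤ r := by
  classical
  obtain ⟨N, hN, hmax⟩ := Finset.exists_max_image
    (P.powerset.filter fun N => ∀ x ∈ N, ∀ y ∈ N, x ≠ y → r ≤ dist x y) Finset.card
    ⟨∅, by simp⟩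
  rw [Finset.mem_filter, Finset.mem_powerset] at hN
  refine ⟨N, hN.1, hN.2, fun x hx => ?_⟩
  by_contra! hfar
  have hxN : x ∉ N := fun h => by
    have := hfar x h
    rw [dist_self] at this
    linarith
  have := hmax (insert x N) (by
    rw [Finset.mem_filter, Finset.mem_powerset]
    refine ⟨Finset.insert_subset hx hN.1, ?_⟩
    intro a ha b hb hab
    rw [Finset.mem_insert] at ha hb
    rcases ha with rfl | ha <;> rcases hb with rfl | hb
    · exact absurd rfl hab
    · exact (hfar b hb).le
    · rw [dist_comm]; exact (hfar a ha).le
    · exact hN.2 a ha b hb hab)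
  rw [Finset.card_insert_of_notMem hxN] at this
  omega

/-! ### Orthonormal frames and near-straight paths -/

/-- The Euclidean plane. -/
abbrev Plane := EuclideanSpace ℝ (Fin 2)

/-- `d` and `e` form an orthonormal basis of the plane; that they span is expressed by Parseval's
identity. -/
structure IsFrame (d e : Plane) : Prop where
  inner_left : inner ℝ d d = 1
  inner_right : inner ℝ e e = 1
  inner_cross : inner ℝ d e = 0
  norm_sq : ∀ w : Plane, ‖w‖ ^ 2 = inner ℝ d w ^ 2 + inner ℝ e w ^ 2

namespace IsFrame

variable {d e : Plane}

lemma neg (h : IsFrame d e) : IsFrame (-d) e where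
  inner_left := by simpa using h.inner_left
  inner_right := h.inner_right
  inner_cross := by simpa using h.inner_cross
  norm_sq w := by rw [h.norm_sq w, inner_neg_left, neg_sq]

lemma norm_left (h : IsFrame d e) : ‖d‖ = 1 := by
  have := real_inner_self_eq_norm_sq d
  rw [h.inner_left] at this
  nlinarith [norm_nonneg d]

lemma norm_right (h : IsFrame d e) : ‖e‖ = 1 := by
  have := real_inner_self_eq_norm_sq e
  rw [h.inner_right] at this
  nlinarith [norm_nonneg e]

lemma abs_inner_left_le (h : IsFrame d e) (w : Plane) : |inner ℝ d w| ≤ ‖w‖ := by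
  simpa [h.norm_left] using abs_real_inner_le_norm d w

lemma abs_inner_right_le (h : IsFrame d e) (w : Plane) : |inner ℝ e w| ≤ ‖w‖ := by
  simpa [h.norm_right] using abs_real_inner_le_norm e w

lemma norm_le_abs_add_abs (h : IsFrame d e) (w : Plane) :
    ‖w‖ ≤ |inner ℝ d w| + |inner ℝ e w| := by
  have h1 := h.norm_sq w
  rw [← sq_abs (inner ℝ d w), ← sq_abs (inner ℝ e w)] at h1
  have h2 := abs_nonneg (inner ℝ d w)
  have h3 := abs_nonneg (inner ℝ e w)
  refine abs_le_of_sq_le_sq' ?_ (by positivity) |>.2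
  nlinarith [mul_nonneg h2 h3]

/-- A vector whose component across `d` is small is barely longer than its component along `d`. -/
lemma norm_le_inner_add (h : IsFrame d e) {w : Plane} {A B : ℝ} (hA : 0 < A)
    (hw : A ≤ inner ℝ d w) (hB : |inner ℝ e w| ≤ B) :
    ‖w‖ ≤ inner ℝ d w + B ^ 2 / (2 * A) := by
  have h1 := h.norm_sq w
  have hB0 : 0 ≤ B := (abs_nonneg _).trans hB
  have h2 : inner ℝ e w ^ 2 ≤ B ^ 2 := by
    rw [← sq_abs]; exact pow_le_pow_left₀ (abs_nonneg _) hB 2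
  have h3 : B ^ 2 = 2 * A * (B ^ 2 / (2 * A)) := by field_simp
  have h4 : 0 ≤ B ^ 2 / (2 * A) := by positivity
  set t := B ^ 2 / (2 * A)
  refine abs_le_of_sq_le_sq' ?_ (by linarith) |>.2
  nlinarith [mul_le_mul_of_nonneg_right hw h4, sq_nonneg t]

end IsFrame

/-- The error term is quadratic in the perturbation `v`, whatever its direction; the first order
term `inner ℝ d v` telescopes along a path. -/
lemma norm_smul_add_le {E : Type*} [NormedAddCommGroup E] [InnerProductSpace ℝ E] {d v : E}
    (hd : ‖d‖ = 1) {l : ℝ} (hl : 0 < l) :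
    ‖l • d + v‖ ≤ l + inner ℝ d v + ‖v‖ ^ 2 / (2 * l) := by
  have h1 : ‖l • d + v‖ ^ 2 = l ^ 2 + 2 * (l * inner ℝ d v) + ‖v‖ ^ 2 := by
    rw [norm_add_sq_real, norm_smul, hd, real_inner_smul_left, mul_one, Real.norm_eq_abs, sq_abs]
  have h2 : l + inner ℝ d v + ‖v‖ ^ 2 / (2 * l) = (‖l • d + v‖ ^ 2 + l ^ 2) / (2 * l) := by
    rw [h1]; field_simp; ring
  rw [h2, le_div_iff₀ (by positivity)]
  nlinarith [sq_nonneg (‖l • d + v‖ - l)]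

/-- The unit vector at angle `t`. -/
noncomputable def unitVec (t : ℝ) : Plane := !₂[Real.cos t, Real.sin t]

/-- The unit vector at angle `t + π / 2`. -/
noncomputable def unitNormal (t : ℝ) : Plane := !₂[-Real.sin t, Real.cos t]

lemma isFrame_unitVec (t : ℝ) : IsFrame (unitVec t) (unitNormal t) where
  inner_left := by
    rw [real_inner_self_eq_norm_sq, EuclideanSpace.real_norm_sq_eq]
    simp [unitVec, Fin.sum_univ_two]
  inner_right := by
    rw [real_inner_self_eq_norm_sq, EuclideanSpace.real_norm_sq_eq]
    simp [unitNormal, Fin.sum_univ_two]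
  inner_cross := by
    simp [unitVec, unitNormal, PiLp.inner_apply, Fin.sum_univ_two]
    ring
  norm_sq w := by
    rw [EuclideanSpace.real_norm_sq_eq]
    simp [unitVec, unitNormal, PiLp.inner_apply, Fin.sum_univ_two]
    linear_combination (-(w 0) ^ 2 - (w 1) ^ 2) * Real.sin_sq_add_cos_sq t

lemma norm_unitVec_sub_le (s t : ℝ) : ‖unitVec s - unitVec t‖ ≤ |s - t| := by
  refine abs_le_of_sq_le_sq' ?_ (abs_nonneg _) |>.2
  rw [EuclideanSpace.real_norm_sq_eq, sq_abs]
  simp [unitVec, Fin.sum_univ_two]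
  have h1 := Real.one_sub_sq_div_two_le_cos (x := s - t)
  rw [Real.cos_sub] at h1
  nlinarith [Real.sin_sq_add_cos_sq s, Real.sin_sq_add_cos_sq t]

lemma exists_eq_unitVec {u : Plane} (hu : ‖u‖ = 1) :
    ∃ t, 0 ≤ t ∧ t < 2 * Real.pi ∧ u = unitVec t := by
  have h1 : u 0 ^ 2 + u 1 ^ 2 = 1 := by
    have := EuclideanSpace.real_norm_sq_eq u
    rw [hu, Fin.sum_univ_two] at this
    linarith
  set z : ℂ := ⟨u 0, u 1⟩ with hz
  have hz1 : ‖z‖ = 1 := by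
    have : ‖z‖ ^ 2 = 1 := by
      rw [Complex.sq_norm, Complex.normSq_apply]; simp only [hz]; linarith
    nlinarith [norm_nonneg z]
  have hz0 : z ≠ 0 := by
    intro h; rw [h, norm_zero] at hz1; exact zero_ne_one hz1
  have hc : Real.cos z.arg = u 0 := by rw [Complex.cos_arg hz0, hz1, div_one]
  have hs : Real.sin z.arg = u 1 := by rw [Complex.sin_arg, hz1, div_one]
  have hlo := Complex.neg_pi_lt_arg z
  have hhi := Complex.arg_le_pi z
  have hpi := Real.pi_pos
  rcases le_or_gt 0 z.arg with h | h
  · refine ⟨z.arg, h, by linarith, ?_⟩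
    ext i; fin_cases i <;> simp [unitVec, hc, hs]
  · refine ⟨z.arg + 2 * Real.pi, by linarith, by linarith, ?_⟩
    ext i; fin_cases i <;> simp [unitVec, hc, hs]

/-- `7 * 2 ^ J` directions suffice to approximate all directions within `2 ^ (-J)`,
because `2 * π < 7`. -/
lemma exists_near_direction (J : ℕ) {u : Plane} (hu : ‖u‖ = 1) :
    ∃ k ∈ Finset.range (7 * 2 ^ J), ‖u - unitVec (k * (1 / 2) ^ J)‖ ≤ (1 / 2) ^ J := by
  obtain ⟨t, h0, h1, rfl⟩ := exists_eq_unitVec hu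
  have hpi := Real.pi_lt_d2
  set y : ℝ := t * 2 ^ J with hy
  have hp : (0 : ℝ) < 2 ^ J := by positivity
  have hy0 : 0 ≤ y := by positivity
  have hfl := Nat.floor_le hy0
  have hlt := Nat.lt_floor_add_one y
  have ht : t = y * (1 / 2) ^ J := by
    rw [hy, one_div, inv_pow]; field_simp
  refine ⟨⌊y⌋₊, ?_, (norm_unitVec_sub_le _ _).trans ?_⟩
  · rw [Finset.mem_range, Nat.floor_lt hy0]
    push_cast
    rw [hy]
    gcongr
    linarith
  · have hq : (0 : ℝ) < (1 / 2) ^ J := by positivity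
    rw [ht, ← sub_mul, abs_mul, abs_of_pos hq]
    have : |y - ⌊y⌋₊| ≤ 1 := by rw [abs_le]; constructor <;> linarith
    nlinarith

/-! ### Tapering trees in a fixed direction -/

/-- The radius of the net at level `i`, for distances of order `L` and resolution `2 ^ (-J)`. -/
noncomputable def netRadius (L : ℝ) (J i : ℕ) : ℝ := L * (1 / 2) ^ J * (1 / 2) ^ i

/-- How far the copies of the net points at level `i` are pushed out. It vanishes at the finest
level `J`. The ratio `1 / 3` of its increments lies strictly between `1 / 4` and `1 / 2`: being
below `1 / 2` makes the weights of the levels a geometric series, and being above `1 / 4` makes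
the excess lengths one. -/
noncomputable def pushOut (L : ℝ) (J i : ℕ) : ℝ := L / 10 * ((1 / 3) ^ i - (1 / 3) ^ J)

lemma netRadius_pos {L : ℝ} (hL : 0 < L) (J i : ℕ) : 0 < netRadius L J i := by
  unfold netRadius; positivity

lemma netRadius_zero_le {L : ℝ} (hL : 0 < L) {J : ℕ} (hJ : 4 ≤ J) :
    netRadius L J 0 ≤ L / 16 := by
  have : (1 / 2 : ℝ) ^ J ≤ (1 / 2) ^ 4 := pow_le_pow_of_le_one (by norm_num) (by norm_num) hJ
  unfold netRadius
  nlinarith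

lemma pushOut_self (L : ℝ) (J : ℕ) : pushOut L J J = 0 := by simp [pushOut]

lemma pushOut_zero_nonneg {L : ℝ} (hL : 0 < L) (J : ℕ) : 0 ≤ pushOut L J 0 := by
  have : (1 / 3 : ℝ) ^ J ≤ 1 := pow_le_one₀ (by norm_num) (by norm_num)
  unfold pushOut
  rw [pow_zero]
  exact mul_nonneg (by positivity) (by linarith)

lemma pushOut_zero_le {L : ℝ} (hL : 0 < L) (J : ℕ) : pushOut L J 0 ≤ L / 10 := by
  have : (0 : ℝ) < (1 / 3 : ℝ) ^ J := by positivity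
  unfold pushOut
  rw [pow_zero]
  nlinarith

lemma pushOut_sub (L : ℝ) (J i : ℕ) :
    pushOut L J i - pushOut L J (i + 1) = L / 15 * (1 / 3) ^ i := by
  unfold pushOut
  rw [pow_succ]
  ring

/-- A hierarchy of nets of `P`: the finite set `net i` has at most `4 * W / netRadius L J i`
points, and every point of `P` is within `netRadius L J i` of the point `near i` of `net i`. -/
structure NetHierarchy (P : Finset Plane) (W L : ℝ) (J : ℕ) where
  /-- the net at each level -/
  net : ℕ → Finset Plane
  /-- a nearby point of the net at each level -/
  near : ℕ → Plane → Plane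
  net_subset : ∀ i, net i ⊆ P
  near_mem : ∀ i, ∀ x ∈ P, near i x ∈ net i
  dist_near_le : ∀ i, ∀ x ∈ P, dist x (near i x) ≤ netRadius L J i
  card_mul_le : ∀ i, (net i).card * netRadius L J i ≤ 4 * W

namespace NetHierarchy

variable {P : Finset Plane} {W L : ℝ} {J : ℕ} (H : NetHierarchy P W L J)

open Classical in
/-- The edges from the pushed-out copy of a net point to the one of a nearby point of the next
coarser net, in the direction `c`. -/
noncomputable def taper (c : Plane) : Finset (Plane × Plane) :=
  (Finset.range J).biUnion fun i => (H.net (i + 1)).image fun x =>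
    (x + pushOut L J (i + 1) • c, H.near i x + pushOut L J i • c)

include H in
lemma weight_nonneg (hL : 0 < L) : 0 ≤ W := by
  have := H.card_mul_le 0
  have := mul_nonneg (Nat.cast_nonneg (α := ℝ) (H.net 0).card) (netRadius_pos hL J 0).le
  linarith

lemma totalLength_taper_le (hL : 0 < L) {c : Plane} (hc : ‖c‖ = 1) :
    totalLength (H.taper c) ≤ 48 * W * 2 ^ J := by
  classical
  have hW := H.weight_nonneg hL
  have hlevel : ∀ i ∈ Finset.range J, totalLength ((H.net (i + 1)).image fun x =>
      (x + pushOut L J (i + 1) • c, H.near i x + pushOut L J i • c))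
      ≤ 16 * W * 2 ^ J * (2 / 3) ^ i := by
    intro i hi
    have hiJ : i ≤ J := (Finset.mem_range.1 hi).le
    refine (totalLength_image_le _ _ (B := 2 * L * (1 / 3) ^ i) fun x hx => ?_).trans ?_
    · have h1 := H.dist_near_le i x (H.net_subset _ hx)
      rw [dist_eq_norm] at h1 ⊢
      have h2 : x + pushOut L J (i + 1) • c - (H.near i x + pushOut L J i • c)
          = (x - H.near i x) - (pushOut L J i - pushOut L J (i + 1)) • c := by
        rw [sub_smul]; abel
      have h3 : ‖(pushOut L J i - pushOut L J (i + 1)) • c‖ = L / 15 * (1 / 3) ^ i := by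
        rw [norm_smul, hc, mul_one, pushOut_sub, Real.norm_eq_abs, abs_of_nonneg (by positivity)]
      have h4 : netRadius L J i ≤ L * (1 / 3) ^ i := by
        unfold netRadius
        rw [mul_assoc]
        gcongr
        calc (1 / 2 : ℝ) ^ J * (1 / 2) ^ i ≤ (1 / 2) ^ i * (1 / 2) ^ i := by
              gcongr ?_ * _
              exact pow_le_pow_of_le_one (by norm_num) (by norm_num) hiJ
          _ = (1 / 4) ^ i := by rw [← mul_pow]; norm_num
          _ ≤ (1 / 3) ^ i := by gcongr; norm_num
      change ‖x + pushOut L J (i + 1) • c - (H.near i x + pushOut L J i • c)‖ ≤ _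
      rw [h2]
      refine (norm_sub_le _ _).trans ?_
      rw [h3]
      have : 0 ≤ L * (1 / 3) ^ i := by positivity
      nlinarith
    · have h1 := H.card_mul_le (i + 1)
      have h2 : 2 * L * (1 / 3) ^ i = netRadius L J (i + 1) * (4 * 2 ^ J * (2 / 3) ^ i) := by
        have e1 : (1 / 2 : ℝ) ^ J * 2 ^ J = 1 := by rw [← mul_pow]; norm_num
        have e2 : (1 / 2 : ℝ) ^ i * (2 / 3) ^ i = (1 / 3) ^ i := by rw [← mul_pow]; norm_num
        unfold netRadius
        rw [pow_succ]
        linear_combination (-(2 * L * (1 / 2) ^ i * (2 / 3) ^ i)) * e1 - 2 * L * e2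
      rw [h2, ← mul_assoc]
      have : (0 : ℝ) ≤ 4 * 2 ^ J * (2 / 3) ^ i := by positivity
      nlinarith [mul_le_mul_of_nonneg_right h1 this]
  refine (totalLength_biUnion_le _ _).trans ((Finset.sum_le_sum hlevel).trans ?_)
  rw [← Finset.mul_sum, geom_sum_eq (by norm_num)]
  have h1 : (0 : ℝ) ≤ (2 / 3) ^ J := by positivity
  have h2 : 0 ≤ W * 2 ^ J := by positivity
  have h3 : ((2 / 3 : ℝ) ^ J - 1) / (2 / 3 - 1) ≤ 3 := by
    rw [div_le_iff_of_neg (by norm_num)]; linarith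
  nlinarith

/-- Climbing from the finest net `net J` to level `i`. Up to a small excess, the length of the
path is its displacement in the direction `c`. -/
lemma exists_pathLE_taper (hL : 0 < L) {c : Plane} (hc : ‖c‖ = 1) {p : Plane} (hp : p ∈ H.net J)
    (k i : ℕ) (hik : i + k = J) :
    ∃ x ∈ H.net i, ‖x - p‖ ≤ 2 * netRadius L J i - 2 * netRadius L J J ∧
      PathLE (H.taper c) p (x + pushOut L J i • c)
        (pushOut L J i + inner ℝ c (x - p)
          + 30 * netRadius L J J * ((3 / 4) ^ i - (3 / 4) ^ J)) := by
  classical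
  induction k generalizing i with
  | zero =>
    obtain rfl : i = J := by simpa using hik
    refine ⟨p, hp, by simp, ?_⟩
    rw [pushOut_self, zero_smul, add_zero]
    exact .nil _ _ (by simp)
  | succ k ih =>
    obtain ⟨x, hx, hxp, hpath⟩ := ih (i + 1) (by omega)
    have hxP := H.net_subset _ hx
    refine ⟨H.near i x, H.near_mem i x hxP, ?_, ?_⟩
    · have h1 := H.dist_near_le i x hxP
      rw [dist_comm, dist_eq_norm] at h1
      have h2 : H.near i x - p = (H.near i x - x) + (x - p) := by abel
      have h3 : netRadius L J i = 2 * netRadius L J (i + 1) := by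
        unfold netRadius; rw [pow_succ]; ring
      rw [h2]
      refine (norm_add_le _ _).trans ?_
      linarith
    · have hiJ : i < J := by omega
      have hmem : (x + pushOut L J (i + 1) • c, H.near i x + pushOut L J i • c) ∈ H.taper c :=
        Finset.mem_biUnion.2 ⟨i, Finset.mem_range.2 hiJ, Finset.mem_image_of_mem _ hx⟩
      refine (hpath.trans (PathLE.single (.inl hmem) le_rfl)).mono_length ?_
      have h1 := H.dist_near_le i x hxP
      rw [dist_comm, dist_eq_norm] at h1
      set v := H.near i x - x with hv
      have hl : 0 < L / 15 * (1 / 3 : ℝ) ^ i := by positivity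
      have h2 := norm_smul_add_le (v := v) hc hl
      have h3 : dist (x + pushOut L J (i + 1) • c) (H.near i x + pushOut L J i • c)
          = ‖(L / 15 * (1 / 3 : ℝ) ^ i) • c + v‖ := by
        rw [dist_comm, dist_eq_norm, ← pushOut_sub L J i, sub_smul, hv]
        congr 1; abel
      have h4 : ‖v‖ ^ 2 / (2 * (L / 15 * (1 / 3 : ℝ) ^ i))
          ≤ 30 * netRadius L J J * (3 / 4) ^ i * (1 / 4) := by
        rw [div_le_iff₀ (by positivity)]
        have h5 : ‖v‖ ^ 2 ≤ netRadius L J i ^ 2 := pow_le_pow_left₀ (norm_nonneg _) h1 2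
        refine h5.trans (le_of_eq ?_)
        have e1 : (3 / 4 : ℝ) ^ i * (1 / 3) ^ i = (1 / 2) ^ i * (1 / 2) ^ i := by
          rw [← mul_pow, ← mul_pow]; norm_num
        unfold netRadius
        linear_combination (-(L ^ 2 * (1 / 2) ^ J * (1 / 2) ^ J)) * e1
      have h5 : inner ℝ c (H.near i x - p) = inner ℝ c (x - p) + inner ℝ c v := by
        rw [← inner_add_right, hv]
        congr 1; abel
      have h6 := pushOut_sub L J i
      rw [h3, h5, pow_succ]
      linarith

end NetHierarchy

/-! ### Hubs -/

/-- The hub with coordinates `(a, b)`: a point of the lattice with steps `L / 10` in the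
direction `d` and `netRadius L J 0 = L / 2 ^ J` in the direction `e`. -/
noncomputable def hub (L : ℝ) (J : ℕ) (d e : Plane) (a b : ℤ) : Plane :=
  (a * (L / 10)) • d + (b * netRadius L J 0) • e

lemma IsFrame.inner_left_hub {d e : Plane} (h : IsFrame d e) (L : ℝ) (J : ℕ) (a b : ℤ) :
    inner ℝ d (hub L J d e a b) = a * (L / 10) := by
  rw [hub, inner_add_right, real_inner_smul_right, real_inner_smul_right, h.inner_left,
    h.inner_cross]
  ring

lemma IsFrame.inner_right_hub {d e : Plane} (h : IsFrame d e) (L : ℝ) (J : ℕ) (a b : ℤ) :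
    inner ℝ e (hub L J d e a b) = b * netRadius L J 0 := by
  rw [hub, inner_add_right, real_inner_smul_right, real_inner_smul_right, h.inner_right,
    real_inner_comm, h.inner_cross]
  ring

/-- The first hub coordinate of a point. -/
noncomputable def hubFst (L : ℝ) (d x : Plane) : ℤ := ⌊inner ℝ d x / (L / 10)⌋

/-- The second hub coordinate of a point. -/
noncomputable def hubSnd (L : ℝ) (J : ℕ) (e x : Plane) : ℤ := ⌊inner ℝ e x / netRadius L J 0⌋

lemma abs_floor_add_mul_sub_le {s : ℝ} (hs : 0 < s) (X : ℝ) (u : ℤ) {A : ℝ} (hu : |(u : ℝ)| ≤ A) :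
    |((⌊X / s⌋ + u : ℤ) : ℝ) * s - X| ≤ (A + 1) * s := by
  have h1 := Int.floor_le (X / s)
  have h2 := Int.lt_floor_add_one (X / s)
  have h3 : X = X / s * s := by field_simp
  have h4 : ((⌊X / s⌋ + u : ℤ) : ℝ) * s - X = (⌊X / s⌋ + u - X / s) * s := by
    push_cast
    linear_combination -h3
  rw [h4, abs_mul, abs_of_pos hs]
  gcongr
  rw [abs_le] at hu ⊢
  constructor <;> linarith

lemma abs_floor_sub_floor_lt {s : ℝ} (hs : 0 < s) {X Z A : ℝ} (h : |Z - X| ≤ A * s) :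
    |((⌊Z / s⌋ - ⌊X / s⌋ : ℤ) : ℝ)| < A + 1 := by
  have h1 := Int.floor_le (X / s)
  have h2 := Int.lt_floor_add_one (X / s)
  have h3 := Int.floor_le (Z / s)
  have h4 := Int.lt_floor_add_one (Z / s)
  have h5 : |Z / s - X / s| ≤ A := by
    rw [← sub_div, abs_div, abs_of_pos hs, div_le_iff₀ hs]; exact h
  rw [abs_le] at h5
  rw [abs_lt]
  push_cast
  constructor <;> linarith

namespace NetHierarchy

variable {P : Finset Plane} {W L : ℝ} {J : ℕ} (H : NetHierarchy P W L J)

open Classical in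
/-- The edges from the coarsest net points, pushed out in the direction `c`, to the boundedly
many hubs near them. The hubs are those of the frame `d`, `e` for both `c = d` and `c = -d`, so
that paths in opposite directions meet. The ranges contain all hubs of points `z` with
`|inner d (z - x)| ≤ 1.25 * L` and `|inner e (z - x)| ≤ 3.5 * netRadius L J 0`. -/
noncomputable def spokes (d e c : Plane) : Finset (Plane × Plane) :=
  (H.net 0 ×ˢ Finset.Icc (-13 : ℤ) 13 ×ˢ Finset.Icc (-4 : ℤ) 4).image fun t =>
    (t.1 + pushOut L J 0 • c, hub L J d e (hubFst L d t.1 + t.2.1) (hubSnd L J e t.1 + t.2.2))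

lemma totalLength_spokes_le (hL : 0 < L) (hJ : 4 ≤ J) {d e c : Plane} (h : IsFrame d e)
    (hc : ‖c‖ = 1) : totalLength (H.spokes d e c) ≤ 1944 * W * 2 ^ J := by
  classical
  have hr := netRadius_pos hL J 0
  have hr1 := netRadius_zero_le hL hJ
  refine (totalLength_image_le _ _ (B := 2 * L) ?_).trans ?_
  · rintro ⟨x, u, v⟩ ht
    simp only [Finset.mem_product, Finset.mem_Icc] at ht
    obtain ⟨-, ⟨hu1, hu2⟩, hv1, hv2⟩ := ht
    have hu : |(u : ℝ)| ≤ 13 := by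
      rw [abs_le]; exact ⟨by exact_mod_cast hu1, by exact_mod_cast hu2⟩
    have hv : |(v : ℝ)| ≤ 4 := by
      rw [abs_le]; exact ⟨by exact_mod_cast hv1, by exact_mod_cast hv2⟩
    change dist (x + pushOut L J 0 • c)
      (hub L J d e (hubFst L d x + u) (hubSnd L J e x + v)) ≤ 2 * L
    set y := hub L J d e (hubFst L d x + u) (hubSnd L J e x + v) with hy
    have h1 : |inner ℝ d (y - x)| ≤ (13 + 1) * (L / 10) := by
      rw [inner_sub_right, hy, h.inner_left_hub]
      exact abs_floor_add_mul_sub_le (by positivity) _ _ hu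
    have h2 : |inner ℝ e (y - x)| ≤ (4 + 1) * netRadius L J 0 := by
      rw [inner_sub_right, hy, h.inner_right_hub]
      exact abs_floor_add_mul_sub_le hr _ _ hv
    have h3 := h.norm_le_abs_add_abs (y - x)
    have h4 : ‖pushOut L J 0 • c‖ ≤ L / 10 := by
      rw [norm_smul, hc, mul_one, Real.norm_eq_abs, abs_of_nonneg (pushOut_zero_nonneg hL J)]
      exact pushOut_zero_le hL J
    rw [dist_comm, dist_eq_norm, ← sub_sub]
    refine (norm_sub_le _ _).trans ?_
    linarith
  · have h1 := H.card_mul_le 0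
    have h2 : L = netRadius L J 0 * 2 ^ J := by
      unfold netRadius
      rw [pow_zero, mul_one, mul_assoc, ← mul_pow]; norm_num
    have h3 : (H.net 0 ×ˢ Finset.Icc (-13 : ℤ) 13 ×ˢ Finset.Icc (-4 : ℤ) 4).card
        = (H.net 0).card * 243 := by
      simp [Finset.card_product]
    rw [h3]
    push_cast
    have h4 := mul_le_mul_of_nonneg_right h1 (by positivity : (0 : ℝ) ≤ 2 ^ J)
    rw [mul_assoc ((H.net 0).card : ℝ), ← h2] at h4
    linarith

/-- A net point near `p` is joined to the hub of any point `z` which lies roughly in the direction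
`c` from `p`, at distance of order `L`. The length of the path is, up to a small excess, its
displacement in the direction `c`. -/
lemma exists_pathLE_hub (hL : 0 < L) (hJ : 4 ≤ J) {d e c : Plane} (h : IsFrame d e)
    (hc : c = d ∨ c = -d) {p z : Plane} (hp : p ∈ P) (hpz : ‖z - p‖ ≤ L)
    (hlong : 45 / 100 * L ≤ inner ℝ c (z - p)) (hcross : |inner ℝ e (z - p)| ≤ netRadius L J 0) :
    ∃ p' ∈ P, dist p p' ≤ netRadius L J J ∧
      ∀ S, H.taper c ⊆ S → H.spokes d e c ⊆ S →
        PathLE S p' (hub L J d e (hubFst L d z) (hubSnd L J e z))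
          (inner ℝ c (hub L J d e (hubFst L d z) (hubSnd L J e z) - p')
            + 94 * netRadius L J J) := by
  classical
  have hr := netRadius_pos hL J 0
  have hrJ := netRadius_pos hL J J
  have hr1 := netRadius_zero_le hL hJ
  have hfr : IsFrame c e := by
    rcases hc with rfl | rfl
    · exact h
    · exact h.neg
  have hp' := H.near_mem J p hp
  have hdp := H.dist_near_le J p hp
  set p' := H.near J p with hp'_def
  obtain ⟨x, hx, hxp, hpath⟩ := H.exists_pathLE_taper hL hfr.norm_left hp' J 0 (by simp)
  refine ⟨p', H.net_subset _ hp', hdp, fun S hS1 hS2 => ?_⟩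
  rw [dist_comm, dist_eq_norm] at hdp
  have hxp2 : ‖p - x‖ ≤ 2 * netRadius L J 0 := by
    have : p - x = -((x - p') + (p' - p)) := by abel
    rw [this, norm_neg]
    refine (norm_add_le _ _).trans ?_
    linarith
  have hzx : z - x = (z - p) + (p - x) := by abel
  have hzx_norm : ‖z - x‖ ≤ L + L / 8 := by
    rw [hzx]
    refine (norm_add_le _ _).trans ?_
    linarith
  have hzx_long : 45 / 100 * L - L / 8 ≤ inner ℝ c (z - x) := by
    rw [hzx, inner_add_right]
    have := (abs_le.1 (hfr.abs_inner_left_le (p - x))).1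
    linarith
  have hzx_cross : |inner ℝ e (z - x)| ≤ 3 * netRadius L J 0 := by
    rw [hzx, inner_add_right]
    refine (abs_add_le _ _).trans ?_
    have := hfr.abs_inner_right_le (p - x)
    linarith
  set y := hub L J d e (hubFst L d z) (hubSnd L J e z) with hy
  have hzero : |((0 : ℤ) : ℝ)| ≤ 0 := by simp
  have hyz_left : |inner ℝ d (y - z)| ≤ L / 10 := by
    rw [inner_sub_right, hy, h.inner_left_hub]
    simpa [hubFst] using abs_floor_add_mul_sub_le (by positivity : 0 < L / 10) (inner ℝ d z) 0 hzero
  have hyz_long : |inner ℝ c (y - z)| ≤ L / 10 := by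
    rcases hc with rfl | rfl
    · exact hyz_left
    · rwa [inner_neg_left, abs_neg]
  have hyz_cross : |inner ℝ e (y - z)| ≤ netRadius L J 0 := by
    rw [inner_sub_right, hy, h.inner_right_hub]
    simpa [hubSnd] using abs_floor_add_mul_sub_le hr (inner ℝ e z) 0 hzero
  have hmem : (x + pushOut L J 0 • c, y) ∈ H.spokes d e c := by
    refine Finset.mem_image.2 ⟨(x, hubFst L d z - hubFst L d x,
      hubSnd L J e z - hubSnd L J e x), ?_, by simp [hy]⟩
    have h1 : |((hubFst L d z - hubFst L d x : ℤ) : ℝ)| < ((14 : ℤ) : ℝ) := by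
      refine (abs_floor_sub_floor_lt (A := 12.5) (by positivity) ?_).trans (by norm_num)
      rw [← inner_sub_right]
      refine (h.abs_inner_left_le _).trans ?_
      linarith
    have h2 : |((hubSnd L J e z - hubSnd L J e x : ℤ) : ℝ)| < ((5 : ℤ) : ℝ) := by
      refine (abs_floor_sub_floor_lt (A := 3.5) hr ?_).trans (by norm_num)
      rw [← inner_sub_right]
      linarith
    rw [← Int.cast_abs, Int.cast_lt, abs_lt] at h1 h2
    simp only [Finset.mem_product, Finset.mem_Icc]
    exact ⟨hx, ⟨by omega, by omega⟩, by omega, by omega⟩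
  refine ((hpath.mono_set hS1).trans
    (PathLE.single (.inl (hS2 hmem)) le_rfl)).mono_length ?_
  set w := y - (x + pushOut L J 0 • c) with hw
  have hw_eq : w = (y - z) + (z - x) - pushOut L J 0 • c := by rw [hw]; abel
  have hg := pushOut_zero_le hL J
  have hw_inner : inner ℝ c w = inner ℝ c (y - z) + inner ℝ c (z - x) - pushOut L J 0 := by
    rw [hw_eq, inner_sub_right, inner_add_right, real_inner_smul_right, hfr.inner_left, mul_one]
  have hw_long : L / 8 ≤ inner ℝ c w := by
    rw [hw_inner]
    have := (abs_le.1 hyz_long).1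
    linarith
  have hw_cross : |inner ℝ e w| ≤ 4 * netRadius L J 0 := by
    rw [hw_eq, inner_sub_right, inner_add_right, real_inner_smul_right, real_inner_comm c e,
      hfr.inner_cross, mul_zero, sub_zero]
    refine (abs_add_le _ _).trans ?_
    linarith
  have hw_norm := hfr.norm_le_inner_add (by positivity : 0 < L / 8) hw_long hw_cross
  -- In multiples of `netRadius L J J`, this adds `64` to the excess `30` of the tapering tree.
  have hexc : (4 * netRadius L J 0) ^ 2 / (2 * (L / 8)) = 64 * netRadius L J J := by
    unfold netRadius; field_simp; ring
  have hinner : inner ℝ c (y - p') = inner ℝ c (y - z) + inner ℝ c (z - x)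
      + inner ℝ c (x - p') := by
    rw [← inner_add_right, ← inner_add_right]
    congr 1; abel
  have h34 : (0 : ℝ) ≤ (3 / 4) ^ J := by positivity
  rw [dist_comm, dist_eq_norm, ← hw, hinner]
  rw [hexc, hw_inner] at hw_norm
  have := mul_nonneg hrJ.le h34
  rw [pow_zero]
  linarith

end NetHierarchy

/-! ### A single scale of distances -/

lemma netRadius_self (L : ℝ) (J : ℕ) : netRadius L J J = L * (1 / 4) ^ J := by
  unfold netRadius
  rw [mul_assoc, ← mul_pow]
  norm_num

lemma netRadius_le {L : ℝ} (hL : 0 < L) (J i : ℕ) : netRadius L J i ≤ L := by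
  unfold netRadius
  have h1 : (1 / 2 : ℝ) ^ J ≤ 1 := pow_le_one₀ (by norm_num) (by norm_num)
  have h2 : (1 / 2 : ℝ) ^ i ≤ 1 := pow_le_one₀ (by norm_num) (by norm_num)
  rw [mul_assoc]
  exact mul_le_of_le_one_right hL.le (mul_le_one₀ h1 (by positivity) h2)

lemma nonempty_netHierarchy {P : Finset Plane} (hP : P.Nonempty) {L : ℝ} (hL : 0 < L)
    (hLP : L ≤ mstWeight P) (J : ℕ) : Nonempty (NetHierarchy P (mstWeight P) L J) := by
  have hnet := fun i => exists_separated_net P (netRadius_pos hL J i)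
  choose N hNP hsep hcover using hnet
  have hnear : ∀ i (x : Plane), ∃ y, x ∈ P → y ∈ N i ∧ dist x y ≤ netRadius L J i := by
    intro i x
    by_cases hx : x ∈ P
    · obtain ⟨y, hy⟩ := hcover i x hx
      exact ⟨y, fun _ => hy⟩
    · exact ⟨x, fun h => absurd h hx⟩
  choose f hf using hnear
  exact ⟨{
    net := N
    near := f
    net_subset := hNP
    near_mem := fun i x hx => (hf i x hx).1
    dist_near_le := fun i x hx => (hf i x hx).2
    card_mul_le := fun i => card_mul_le_mstWeight hP (hNP i) (netRadius_pos hL J i)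
      ((netRadius_le hL J i).trans hLP) (hsep i) }⟩

/-- For two points at distance in `[L, 2 * L)`, the direction closest to that of `q - p` and the
hub of their midpoint give a path which is longer than the distance by a term of second order
in `2 ^ (-J)` only. -/
lemma exists_graph_at_scale {P : Finset Plane} {W L : ℝ} {J : ℕ} (H : NetHierarchy P W L J)
    (hL : 0 < L) (hJ : 4 ≤ J) :
    ∃ S : Finset (Plane × Plane), totalLength S ≤ 28000 * W * 4 ^ J ∧
      ∀ p ∈ P, ∀ q ∈ P, L ≤ dist p q → dist p q < 2 * L →
        ∃ p' ∈ P, ∃ q' ∈ P, dist p p' ≤ netRadius L J J ∧ dist q q' ≤ netRadius L J J ∧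
          PathLE S p' q' (dist p q + 190 * netRadius L J J) := by
  classical
  have hW := H.weight_nonneg hL
  let A : ℝ → Plane → Finset (Plane × Plane) := fun t c =>
    H.taper c ∪ H.spokes (unitVec t) (unitNormal t) c
  let B : ℝ → Finset (Plane × Plane) := fun t => A t (unitVec t) ∪ A t (-unitVec t)
  let S : Finset (Plane × Plane) :=
    (Finset.range (7 * 2 ^ J)).biUnion fun k => B (k * (1 / 2) ^ J)
  have hA : ∀ t c, ‖c‖ = 1 → totalLength (A t c) ≤ 1992 * W * 2 ^ J := fun t c hc =>
    (totalLength_union_le _ _).trans (by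
      linarith [H.totalLength_taper_le hL hc,
        H.totalLength_spokes_le hL hJ (isFrame_unitVec t) hc])
  have hB : ∀ t, totalLength (B t) ≤ 3984 * W * 2 ^ J := fun t =>
    (totalLength_union_le _ _).trans (by
      linarith [hA t _ (isFrame_unitVec t).norm_left, hA t _ (isFrame_unitVec t).neg.norm_left])
  refine ⟨S, ?_, ?_⟩
  · refine (totalLength_biUnion_le _ _).trans ((Finset.sum_le_sum fun k _ => hB _).trans ?_)
    rw [Finset.sum_const, Finset.card_range, nsmul_eq_mul]
    push_cast
    have h4 : (2 : ℝ) ^ J * 2 ^ J = 4 ^ J := by rw [← mul_pow]; norm_num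
    have : 0 ≤ W * (4 : ℝ) ^ J := by positivity
    calc (7 * 2 ^ J : ℝ) * (3984 * W * 2 ^ J) = 27888 * W * (2 ^ J * 2 ^ J) := by ring
      _ ≤ 28000 * W * 4 ^ J := by rw [h4]; linarith
  · intro p hp q hq hlo hhi
    have hD : 0 < dist p q := hL.trans_le hlo
    have hDn : dist p q = ‖q - p‖ := by rw [dist_comm, dist_eq_norm]
    set D := dist p q with hDdef
    set u : Plane := D⁻¹ • (q - p) with hu
    have hu1 : ‖u‖ = 1 := by
      rw [hu, norm_smul, ← hDn, Real.norm_eq_abs, abs_of_pos (inv_pos.2 hD), inv_mul_cancel₀ hD.ne']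
    have hqp : q - p = D • u := by rw [hu, smul_smul, mul_inv_cancel₀ hD.ne', one_smul]
    obtain ⟨k, hk, hkd⟩ := exists_near_direction J hu1
    set t : ℝ := k * (1 / 2) ^ J
    have hfr := isFrame_unitVec t
    have hBS : B t ⊆ S := fun x hx => Finset.mem_biUnion.2 ⟨k, hk, hx⟩
    set d := unitVec t
    set e := unitNormal t
    have hdelta : (1 / 2 : ℝ) ^ J ≤ 1 / 16 :=
      (pow_le_pow_of_le_one (by norm_num) (by norm_num) hJ).trans (by norm_num)
    have hinner_d : 9 / 10 ≤ inner ℝ d u := by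
      have h1 := norm_sub_sq_real u d
      rw [hu1, hfr.norm_left, real_inner_comm] at h1
      have h2 : ‖u - d‖ ≤ 1 / 16 := hkd.trans hdelta
      nlinarith [norm_nonneg (u - d)]
    have hinner_e : |inner ℝ e u| ≤ (1 / 2) ^ J := by
      have h1 : inner ℝ e u = inner ℝ e (u - d) := by
        rw [inner_sub_right, real_inner_comm d e, hfr.inner_cross, sub_zero]
      rw [h1]
      exact (hfr.abs_inner_right_le _).trans hkd
    set z : Plane := p + (D / 2) • u with hz
    have hzp : z - p = (D / 2) • u := by rw [hz]; abel
    have hzq : z - q = -((D / 2) • u) := by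
      have : z - q = (z - p) - (q - p) := by abel
      rw [this, hzp, hqp, ← sub_smul, ← neg_smul]
      congr 1; ring
    have hnorm : ‖(D / 2) • u‖ ≤ L := by
      rw [norm_smul, hu1, mul_one, Real.norm_eq_abs, abs_of_pos (by positivity)]
      linarith
    have hlong : 45 / 100 * L ≤ inner ℝ d ((D / 2) • u) := by
      rw [real_inner_smul_right]
      nlinarith
    have hcross : |inner ℝ e ((D / 2) • u)| ≤ netRadius L J 0 := by
      rw [real_inner_smul_right, abs_mul, abs_of_pos (by positivity : 0 < D / 2)]
      unfold netRadius
      rw [pow_zero, mul_one]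
      exact mul_le_mul (by linarith) hinner_e (abs_nonneg _) hL.le
    obtain ⟨p', hp', hpp', hpath_p⟩ := H.exists_pathLE_hub hL hJ hfr (.inl rfl) hp (z := z)
      (by rwa [hzp]) (by rwa [hzp]) (by rwa [hzp])
    obtain ⟨q', hq', hqq', hpath_q⟩ := H.exists_pathLE_hub hL hJ hfr (.inr rfl) hq (z := z)
      (by rwa [hzq, norm_neg]) (by rwa [hzq, inner_neg_neg])
      (by rwa [hzq, inner_neg_right, abs_neg])
    refine ⟨p', hp', q', hq', hpp', hqq', ?_⟩
    have h1 := hpath_p S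
      (Finset.subset_union_left.trans (Finset.subset_union_left.trans hBS))
      (Finset.subset_union_right.trans (Finset.subset_union_left.trans hBS))
    have h2 := hpath_q S
      (Finset.subset_union_left.trans (Finset.subset_union_right.trans hBS))
      (Finset.subset_union_right.trans (Finset.subset_union_right.trans hBS))
    refine (h1.trans h2.symm).mono_length ?_
    set y := hub L J d e (hubFst L d z) (hubSnd L J e z)
    have h3 : inner ℝ d (y - p') + inner ℝ (-d) (y - q') = inner ℝ d (q' - p') := by
      rw [inner_neg_left, ← sub_eq_add_neg, ← inner_sub_right]
      congr 1; abel
    have h4 := (le_abs_self _).trans (hfr.abs_inner_left_le (q' - p'))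
    -- In multiples of `netRadius L J J`, the excess is `94` on either side, and `2` more from
    -- passing from `p, q` to the net points.
    have h5 : ‖q' - p'‖ ≤ D + 2 * netRadius L J J := by
      rw [← dist_eq_norm]
      have := dist_triangle4 q' q p p'
      rw [dist_comm q' q, dist_comm q p] at this
      linarith
    linarith

/-! ### All scales -/

/-- The resolution `2 ^ (-J)` is of order `√ε`. -/
lemma exists_resolution {ε : ℝ} (hε : 0 < ε) (hε1 : ε ≤ 1) :
    ∃ J : ℕ, 4 ≤ J ∧ 256 * (1 / 4 : ℝ) ^ J ≤ ε ∧ (4 : ℝ) ^ J ≤ 1024 / ε := by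
  have h256 : 256 ≤ 256 / ε := by rw [le_div_iff₀ hε]; linarith
  obtain ⟨n, hn1, hn2⟩ := exists_nat_pow_near (by linarith : 1 ≤ 256 / ε) (by norm_num : (1:ℝ) < 4)
  refine ⟨n + 1, ?_, ?_, ?_⟩
  · by_contra h
    have : (4 : ℝ) ^ (n + 1) ≤ 4 ^ 3 := pow_le_pow_right₀ (by norm_num) (by omega)
    linarith
  · rw [one_div, inv_pow, ← div_eq_mul_inv, div_le_iff₀ (by positivity)]
    rw [div_lt_iff₀ hε] at hn2
    linarith
  · rw [pow_succ]
    have : 1024 / ε = 256 / ε * 4 := by ring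
    linarith

/-- Induction on the scale of the distance: the short connections from `p` and `q` to the ends of
a path at their own scale are provided by the smaller scales. -/
lemma pathLE_of_scales {P : Finset Plane} {S : Finset (Plane × Plane)} {m ε : ℝ} {J : ℕ}
    (hm : 0 < m) (hmin : ∀ p ∈ P, ∀ q ∈ P, p ≠ q → m ≤ dist p q) (hε : 0 < ε) (hε1 : ε ≤ 1)
    (hJ : 256 * (1 / 4 : ℝ) ^ J ≤ ε)
    (hscale : ∀ n : ℕ, ∀ p ∈ P, ∀ q ∈ P, m * 2 ^ n ≤ dist p q → dist p q < 2 * (m * 2 ^ n) →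
      ∃ p' ∈ P, ∃ q' ∈ P, dist p p' ≤ netRadius (m * 2 ^ n) J J ∧
        dist q q' ≤ netRadius (m * 2 ^ n) J J ∧
        PathLE S p' q' (dist p q + 190 * netRadius (m * 2 ^ n) J J))
    {p q : Plane} (hp : p ∈ P) (hq : q ∈ P) : PathLE S p q ((1 + ε) * dist p q) := by
  have key : ∀ n : ℕ, ∀ p ∈ P, ∀ q ∈ P, dist p q < m * 2 ^ n →
      PathLE S p q ((1 + ε) * dist p q) := by
    intro n
    induction n with
    | zero =>
      intro p hp q hq h
      by_cases hpq : p = q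
      · subst hpq
        exact .nil _ _ (by simp)
      · have := hmin p hp q hq hpq
        rw [pow_zero, mul_one] at h
        linarith
    | succ n ih =>
      intro p hp q hq h
      rcases lt_or_ge (dist p q) (m * 2 ^ n) with hlt | hge
      · exact ih p hp q hq hlt
      · have hL : 0 < m * 2 ^ n := by positivity
        obtain ⟨p', hp', q', hq', hpp', hqq', hpath⟩ := hscale n p hp q hq hge
          (by rw [pow_succ] at h; linarith)
        have hr : 256 * netRadius (m * 2 ^ n) J J ≤ ε * (m * 2 ^ n) := by
          rw [netRadius_self]
          nlinarith
        have hrL : netRadius (m * 2 ^ n) J J < m * 2 ^ n := by nlinarith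
        have h1 := ih p hp p' hp' (hpp'.trans_lt hrL)
        have h2 := ih q hq q' hq' (hqq'.trans_lt hrL)
        refine ((h1.trans hpath).trans h2.symm).mono_length ?_
        have h3 : (1 + ε) * dist p p' ≤ 2 * netRadius (m * 2 ^ n) J J :=
          mul_le_mul (by linarith) hpp' dist_nonneg (by norm_num)
        have h4 : (1 + ε) * dist q q' ≤ 2 * netRadius (m * 2 ^ n) J J :=
          mul_le_mul (by linarith) hqq' dist_nonneg (by norm_num)
        -- The total excess is `190 + 2 + 2` times the finest net radius, while `256` times that
        -- radius is at most `ε * L`.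
        have h5 : ε * (m * 2 ^ n) ≤ ε * dist p q := by gcongr
        have := netRadius_pos hL J J
        linarith
  obtain ⟨n, hn⟩ := pow_unbounded_of_one_lt (dist p q / m) (by norm_num : (1 : ℝ) < 2)
  refine key n p hp q hq ?_
  rw [div_lt_iff₀ hm] at hn
  linarith

theorem theorem1 :
    ∃ C : ℝ, 0 < C ∧
      ∀ ε : ℝ, 0 < ε → ε ≤ 1 →
        ∀ P : Finset (EuclideanSpace ℝ (Fin 2)), 2 ≤ P.card →
          ∃ (V : Finset (EuclideanSpace ℝ (Fin 2))) (G : SimpleGraph V),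
            Geometric.IsSteinerSpanner P G (1 + ε) ∧
              Geometric.weight G ≤
                C * (max 1 (Real.logb 2 (Geometric.spread P)) / ε) * Geometric.mstWeight P := by
  classical
  -- `57344000 = 2 * 28000 * 1024`, from the number of scales, the weight per scale, and `4 ^ J`.
  refine ⟨57344000, by norm_num, fun ε hε hε1 P hcard => ?_⟩
  obtain ⟨J, hJ4, hJε, hJ⟩ := exists_resolution hε hε1
  have hne : P.Nonempty := Finset.card_pos.1 (by omega)
  have hnt : (P : Set Plane).Nontrivial := Finset.one_lt_card_iff_nontrivial.1 (by omega)
  set m := Set.infsep (P : Set Plane) with hm_def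
  have hm : 0 < m := (Set.Finite.infsep_pos_iff_nontrivial P.finite_toSet).2 hnt
  have hmin : ∀ p ∈ P, ∀ q ∈ P, p ≠ q → m ≤ dist p q := fun p hp q hq hpq =>
    Set.infsep_le_dist_of_mem hp hq hpq
  have hdiam : ∀ p ∈ P, ∀ q ∈ P, dist p q ≤ Metric.diam (P : Set Plane) := fun p hp q hq =>
    Metric.dist_le_diam_of_mem P.finite_toSet.isBounded hp hq
  have hspread : spread P * m = Metric.diam (P : Set Plane) := div_mul_cancel₀ _ hm.ne'
  have hdiam_mst : Metric.diam (P : Set Plane) ≤ mstWeight P := by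
    obtain ⟨a, ha⟩ := hne
    exact Metric.diam_le_of_forall_dist_le (dist_nonneg.trans (dist_le_mstWeight ha ha))
      fun p hp q hq => dist_le_mstWeight hp hq
  have hspread1 : 1 ≤ spread P := by
    obtain ⟨a, ha, b, hb, hab⟩ := hnt
    have h1 := (hmin a ha b hb hab).trans (hdiam a ha b hb)
    rw [← hspread] at h1
    by_contra! h
    nlinarith
  have hspread0 : 0 < spread P := by linarith
  have hW : 0 ≤ mstWeight P := Metric.diam_nonneg.trans hdiam_mst
  set lg := Real.logb 2 (spread P) with hlg
  have hlg0 : 0 ≤ lg := Real.logb_nonneg (by norm_num) hspread1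
  have hpow : ∀ n : ℕ, n ≤ ⌊lg⌋₊ ↔ (2 : ℝ) ^ n ≤ spread P := fun n => by
    rw [Nat.le_floor_iff hlg0, hlg, Real.le_logb_iff_rpow_le (by norm_num) hspread0,
      Real.rpow_natCast]
  have hgraph : ∀ n : ℕ, ∃ S : Finset (Plane × Plane), n ≤ ⌊lg⌋₊ →
      totalLength S ≤ 28000 * mstWeight P * 4 ^ J ∧
      ∀ p ∈ P, ∀ q ∈ P, m * 2 ^ n ≤ dist p q → dist p q < 2 * (m * 2 ^ n) →
        ∃ p' ∈ P, ∃ q' ∈ P, dist p p' ≤ netRadius (m * 2 ^ n) J J ∧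
          dist q q' ≤ netRadius (m * 2 ^ n) J J ∧
          PathLE S p' q' (dist p q + 190 * netRadius (m * 2 ^ n) J J) := by
    intro n
    by_cases hn : n ≤ ⌊lg⌋₊
    · have hL : 0 < m * 2 ^ n := by positivity
      have hLW : m * 2 ^ n ≤ mstWeight P := by
        refine le_trans ?_ hdiam_mst
        rw [← hspread, mul_comm]
        exact mul_le_mul_of_nonneg_right ((hpow n).1 hn) hm.le
      obtain ⟨H⟩ := nonempty_netHierarchy hne hL hLW J
      obtain ⟨S, hS⟩ := exists_graph_at_scale H hL hJ4
      exact ⟨S, fun _ => hS⟩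
    · exact ⟨∅, fun h => absurd h hn⟩
  choose S hS using hgraph
  obtain ⟨V, G, hspan, hweight⟩ := exists_isSteinerSpanner_of_pathLE P
    ((Finset.range (⌊lg⌋₊ + 1)).biUnion S) (1 + ε) (by
      intro p hp q hq
      refine pathLE_of_scales hm hmin hε hε1 hJε (fun n p hp q hq hlo hhi => ?_) hp hq
      have hn : n ≤ ⌊lg⌋₊ := by
        rw [hpow]
        have h1 := hlo.trans (hdiam p hp q hq)
        rw [← hspread, mul_comm] at h1
        exact le_of_mul_le_mul_right h1 hm
      obtain ⟨p', hp', q', hq', h1, h2, h3⟩ := (hS n hn).2 p hp q hq hlo hhi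
      exact ⟨p', hp', q', hq', h1, h2, h3.mono_set fun x hx =>
        Finset.mem_biUnion.2 ⟨n, Finset.mem_range.2 (by omega), hx⟩⟩)
  refine ⟨V, G, hspan, hweight.trans ((totalLength_biUnion_le _ _).trans ?_)⟩
  have hsum : ∑ n ∈ Finset.range (⌊lg⌋₊ + 1), totalLength (S n)
      ≤ (⌊lg⌋₊ + 1) * (28000 * mstWeight P * 4 ^ J) := by
    refine (Finset.sum_le_sum fun n hn =>
      (hS n (Nat.lt_succ_iff.1 (Finset.mem_range.1 hn))).1).trans (le_of_eq ?_)
    rw [Finset.sum_const, Finset.card_range, nsmul_eq_mul]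
    push_cast
    rfl
  refine hsum.trans ?_
  have hscales : (⌊lg⌋₊ : ℝ) + 1 ≤ 2 * max 1 lg := by
    linarith [Nat.floor_le hlg0, le_max_left 1 lg, le_max_right 1 lg]
  calc ((⌊lg⌋₊ : ℝ) + 1) * (28000 * mstWeight P * 4 ^ J)
      ≤ (2 * max 1 lg) * (28000 * mstWeight P * (1024 / ε)) := by gcongr
    _ = 57344000 * (max 1 lg / ε) * mstWeight P := by ring
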